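/- Let $n,t\in\mathbb N$ and let $G$ be an infinite ring (associative, not necessarily commutative or unital). Call a map $P=(p_1,\dots,p_t):G^n\to G^t$ polynomial if each $p_l:G^n\to G$ lies in the subring of the ring of all functions $G^n\to G$ (with pointwise operations) generated by the constants and the $n$ coordinate functions; that is, $p_l$ is given by a polynomial in the variables $x_1,\dots,x_n$ over $G$, where, if $G$ is not commutative, coefficients may stand anywhere in a monomial. Let $P:G^n\to G^t$ be a polynomial map with $P(0)=0$, let $F\subset G^n$ be a finite set, let $r\in\mathbb N$, and let $\chi:G^t\to\{1,\dots,r\}$ be a coloring. Then there are $h\in G^t$ and $x\in G$ with $x\neq 0$ such that $\chi$ is constant on the set $$h+P(xF)=\{\,h+P(xv_1,\dots,xv_n) : (v_1,\dots,v_n)\in F\,\}.$$ -/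

import Mathlib

/-- The ring of polynomial functions `G^n → G` in `n` variables over a ring `G` (associative, not
necessarily commutative or unital): the subring of the ring of all functions `G^n → G` generated
by the constants and the coordinates. Its elements are the functions given by finite sums of
monomials in the variables `x₁, …, xₙ`, where coefficients from `G` may stand anywhere among the
(noncommuting) variables. If `G` is commutative and unital, they are the evaluations of elements
of `G[x₁, …, xₙ]`. -/
def polynomialFunctionRing (G : Type*) [NonUnitalRing G] (n : ℕ) :
    NonUnitalSubring ((Fin n → G) → G) :=
  NonUnitalSubring.closure
    (Set.range (fun (c : G) (_ : Fin n → G) => c) ∪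
      Set.range (fun (i : Fin n) (x : Fin n → G) => x i))

/-- `P : G^n → G^t` is a polynomial mapping over `G`: each of its `t` components is given by a
polynomial over `G` in `n` variables. -/
def IsPolynomialMapping {G : Type*} [NonUnitalRing G] {n t : ℕ}
    (P : (Fin n → G) → (Fin t → G)) : Prop :=
  ∀ l : Fin t, (fun x => P x l) ∈ polynomialFunctionRing G n

/-- The coloring `χ` is constant on `M`. -/
def IsMonochromatic {W C : Type*} (χ : W → C) (M : Set W) : Prop :=
  ∀ a ∈ M, ∀ b ∈ M, χ a = χ b

/-! This is a polynomial van der Waerden theorem. Each `x ↦ P (x v)` vanishes at 0 and has finite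
degree in the sense of iterated differences, so only the additive groups matter. For finitely many
such maps, color focusing (`exists_monochromatic_or_focused`) reduces a family `A` to the maps `p (x
+ y) - p y - q x`. Choosing `q` in a class of least degree trades that class for finitely many of
smaller degree (`IsDegreeCover.exists_shiftedFamily`), so the multiset of degrees descends in the
well-founded Dershowitz–Manna order. -/

/-- The maps `f : G → H` between abelian groups whose `d`-fold differences vanish identically,
that is, the polynomial maps of degree less than `d`. -/
def degreeLT (G H : Type*) [AddCommGroup G] [AddCommGroup H] : ℕ → AddSubgroup (G → H)
  | 0 => ⊥
  | d + 1 =>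
    { carrier := {f | ∀ y, (fun x => f (x + y) - f x) ∈ degreeLT G H d}
      zero_mem' := fun y => by
        have h : (fun x => (0 : G → H) (x + y) - (0 : G → H) x) = 0 := by ext; simp
        rw [h]
        exact zero_mem _
      add_mem' := fun {f g} hf hg y => by
        have h : (fun x => (f + g) (x + y) - (f + g) x) =
            (fun x => f (x + y) - f x) + fun x => g (x + y) - g x := by
          ext; simp only [Pi.add_apply]; abel
        rw [h]
        exact add_mem (hf y) (hg y)
      neg_mem' := fun {f} hf y => by
        have h : (fun x => (-f) (x + y) - (-f) x) = -fun x => f (x + y) - f x := by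
          ext; simp only [Pi.neg_apply]; abel
        rw [h]
        exact neg_mem (hf y) }

/-! ### Degree by iterated differences -/

section AbelianGroup

variable {G H : Type*} [AddCommGroup G] [AddCommGroup H]

theorem mem_degreeLT_zero {f : G → H} : f ∈ degreeLT G H 0 ↔ f = 0 := AddSubgroup.mem_bot

theorem mem_degreeLT_succ {d : ℕ} {f : G → H} :
    f ∈ degreeLT G H (d + 1) ↔ ∀ y, (fun x => f (x + y) - f x) ∈ degreeLT G H d := Iff.rfl

theorem degreeLT_le_succ (d : ℕ) : degreeLT G H d ≤ degreeLT G H (d + 1) := by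
  induction d with
  | zero =>
    intro f hf
    rw [mem_degreeLT_zero] at hf
    rw [hf]
    exact zero_mem _
  | succ d ih => exact fun f hf y => ih (hf y)

theorem degreeLT_mono : Monotone (degreeLT G H) := monotone_nat_of_le_succ degreeLT_le_succ

theorem const_mem_degreeLT (d : ℕ) (c : H) : (fun _ : G => c) ∈ degreeLT G H (d + 1) := by
  refine degreeLT_mono (Nat.le_add_left 1 d) fun y => ?_
  rw [mem_degreeLT_zero]
  ext
  simp

theorem eq_zero_of_mem_degreeLT_one {f : G → H} (hf : f ∈ degreeLT G H 1) (h0 : f 0 = 0) :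
    f = 0 := by
  ext y
  have h := congrFun (mem_degreeLT_zero.1 (hf y)) 0
  simpa [h0] using h

/-- The nonconstant part of the difference of `f` has smaller degree than `f`. -/
theorem difference_mem_degreeLT {d : ℕ} {f : G → H} (hf : f ∈ degreeLT G H (d + 2)) (y : G) :
    (fun x => f (x + y) - f x - f y) ∈ degreeLT G H (d + 1) :=
  sub_mem (hf y) (const_mem_degreeLT d (f y))

theorem pi_mem_degreeLT {t : ℕ} {f : G → Fin t → H} (d : ℕ)
    (hf : ∀ l, (fun x => f x l) ∈ degreeLT G H d) : f ∈ degreeLT G (Fin t → H) d := by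
  induction d generalizing f with
  | zero =>
    rw [mem_degreeLT_zero]
    ext x l
    exact congrFun (mem_degreeLT_zero.1 (hf l)) x
  | succ d ih => exact fun y => ih fun l => hf l y

end AbelianGroup

/-! ### Polynomial maps have finite degree along lines -/

section Ring

variable {A G : Type*} [AddCommGroup A] [NonUnitalRing G]

theorem mul_mem_degreeLT {a b : ℕ} {f g : A → G} (hf : f ∈ degreeLT A G a)
    (hg : g ∈ degreeLT A G b) : f * g ∈ degreeLT A G (a + b) := by
  induction hn : a + b generalizing a b f g with
  | zero =>
    obtain rfl : a = 0 := by omega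
    rw [mem_degreeLT_zero] at hf
    rw [hf, zero_mul]
    exact zero_mem _
  | succ n ih =>
    rcases a with _ | a
    · rw [mem_degreeLT_zero] at hf
      rw [hf, zero_mul]
      exact zero_mem _
    rcases b with _ | b
    · rw [mem_degreeLT_zero] at hg
      rw [hg, mul_zero]
      exact zero_mem _
    intro y
    -- Discrete Leibniz rule. In the last product one index is raised by one so that the indices sum
    -- to `n`.
    have h : (fun x => (f * g) (x + y) - (f * g) x) =
        (fun x => f (x + y) - f x) * g + f * (fun x => g (x + y) - g x) +
          (fun x => f (x + y) - f x) * (fun x => g (x + y) - g x) := by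
      ext x
      simp only [Pi.add_apply, Pi.mul_apply]
      noncomm_ring
    rw [h]
    exact add_mem (add_mem (ih (hf y) hg (by omega)) (ih hf (hg y) (by omega)))
      (ih (hf y) (degreeLT_le_succ b (hg y)) (by omega))

/-- A polynomial function has finite degree along every line through the origin. -/
theorem exists_mem_degreeLT_of_mem_polynomialFunctionRing {n : ℕ} {f : (Fin n → G) → G}
    (hf : f ∈ polynomialFunctionRing G n) (v : Fin n → G) :
    ∃ d, (fun x : G => f fun i => x * v i) ∈ degreeLT G G d := by
  induction hf using NonUnitalSubring.closure_induction with
  | mem f hf =>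
    rcases hf with ⟨c, rfl⟩ | ⟨i, rfl⟩
    · exact ⟨1, const_mem_degreeLT 0 c⟩
    · refine ⟨2, fun y => ?_⟩
      have h : (fun x => (x + y) * v i - x * v i) = fun _ => y * v i := by
        ext x
        rw [add_mul, add_sub_cancel_left]
      simp only [h]
      exact const_mem_degreeLT 0 _
  | zero => exact ⟨0, zero_mem _⟩
  | add f g _ _ hf hg =>
    obtain ⟨a, ha⟩ := hf
    obtain ⟨b, hb⟩ := hg
    exact ⟨max a b, add_mem (degreeLT_mono (le_max_left a b) ha)
      (degreeLT_mono (le_max_right a b) hb)⟩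
  | neg f _ hf =>
    obtain ⟨a, ha⟩ := hf
    exact ⟨a, neg_mem ha⟩
  | mul f g _ _ hf hg =>
    obtain ⟨a, ha⟩ := hf
    obtain ⟨b, hb⟩ := hg
    exact ⟨a + b, mul_mem_degreeLT ha hb⟩

theorem IsPolynomialMapping.exists_mem_degreeLT {n t : ℕ} {P : (Fin n → G) → (Fin t → G)}
    (hP : IsPolynomialMapping P) (v : Fin n → G) :
    ∃ d, (fun x : G => P fun i => x * v i) ∈ degreeLT G (Fin t → G) d := by
  choose d hd using fun l => exists_mem_degreeLT_of_mem_polynomialFunctionRing (hP l) v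
  exact ⟨Finset.univ.sup d, pi_mem_degreeLT _ fun l =>
    degreeLT_mono (Finset.le_sup (Finset.mem_univ l)) (hd l)⟩

end Ring

/-! ### Color focusing -/

section Recurrence

universe u v

variable {G : Type v} {H : Type u} [AddCommGroup H]

/-- Every finite coloring of `H` has a monochromatic configuration `{h} ∪ {h + p x | p ∈ A}` with
`x` outside a prescribed finite set, where `h` and `x` can be taken from finite sets that do not
depend on the coloring. -/
def IsPartitionRegularFamily (A : Set (G → H)) : Prop :=
  ∀ (C : Type u) [Finite C] (S : Set G), S.Finite →
    ∃ (D : Set G) (E : Set H), D.Finite ∧ E.Finite ∧ ∀ χ : H → C,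
      ∃ h ∈ E, ∃ x ∈ D, x ∉ S ∧ ∀ p ∈ A, χ (h + p x) = χ h

theorem IsPartitionRegularFamily.empty [Infinite G] :
    IsPartitionRegularFamily (∅ : Set (G → H)) := by
  intro C _ S hS
  obtain ⟨x, hx⟩ := hS.exists_notMem
  exact ⟨{x}, {0}, Set.finite_singleton _, Set.finite_singleton _, fun χ =>
    ⟨0, rfl, x, rfl, hx, by simp⟩⟩

theorem IsPartitionRegularFamily.of_diff_zero {A : Set (G → H)}
    (hA : IsPartitionRegularFamily (A \ {0})) : IsPartitionRegularFamily A := by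
  intro C _ S hS
  obtain ⟨D, E, hD, hE, hDE⟩ := hA C S hS
  refine ⟨D, E, hD, hE, fun χ => ?_⟩
  obtain ⟨h, hh, x, hx, hxS, hmono⟩ := hDE χ
  refine ⟨h, hh, x, hx, hxS, fun p hp => ?_⟩
  by_cases hp0 : p = 0
  · simp [hp0]
  · exact hmono p ⟨hp, hp0⟩

variable [AddCommGroup G]

/-- The family of the maps `x ↦ p (x + y) - p y - q x` with `p ∈ A` and `y ∈ Y`. -/
def shiftedFamily (A : Set (G → H)) (q : G → H) (Y : Set G) : Set (G → H) :=
  Set.image2 (fun p y x => p (x + y) - p y - q x) A Y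

/-- Color focusing: for every `k` either a monochromatic configuration exists, or there are `k`
configurations with a common focus `h` that are monochromatic in different colors. -/
theorem exists_monochromatic_or_focused {A : Set (G → H)} (hA : A.Finite)
    (hA0 : ∀ p ∈ A, p 0 = 0) (q : G → H)
    (hB : ∀ Y : Set G, Y.Finite → IsPartitionRegularFamily (shiftedFamily A q Y))
    (C : Type u) [Finite C] {S : Set G} (hS : S.Finite) (k : ℕ) :
    ∃ (D : Set G) (E : Set H), D.Finite ∧ E.Finite ∧ ∀ χ : H → C,
      (∃ h ∈ E, ∃ x ∈ D, x ∉ S ∧ ∀ p ∈ A, χ (h + p x) = χ h) ∨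
      ∃ h ∈ E, ∃ T : Finset C, T.card = k ∧
        ∀ c ∈ T, ∃ x ∈ D, x ∉ S ∧ ∀ p ∈ A, χ (h + p x) = c := by
  classical
  induction k with
  | zero =>
    exact ⟨∅, {0}, Set.finite_empty, Set.finite_singleton _, fun χ =>
      Or.inr ⟨0, rfl, ∅, rfl, by simp⟩⟩
  | succ k ih =>
    obtain ⟨D, E, hD, hE, hDE⟩ := ih
    -- `Q` holds every focus and every configuration point that can occur. It is finite because `D`
    -- and `E` do not depend on the coloring, so the pattern on `h + Q` is itself a finite coloring
    -- of `h`.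
    let Q : Set H := E ∪ (fun z : H × (G → H) × G => z.1 + z.2.1 z.2.2) '' (E ×ˢ A ×ˢ D)
    have hQ : Q.Finite := hE.union ((hE.prod (hA.prod hD)).image _)
    have : Finite Q := hQ.to_subtype
    -- The shift 0 serves the new configuration, the shifts in `D` the old ones; excluding `S` and
    -- `S - D` keeps `x` and all `x + y` outside `S`.
    obtain ⟨D₁, E₁, hD₁, hE₁, hDE₁⟩ := hB (insert 0 D) (hD.insert 0) (Q → C)
      (S ∪ Set.image2 (fun s y => s - y) S D) (hS.union (hS.image2 _ hD))
    refine ⟨D ∪ D₁ ∪ Set.image2 (· + ·) D₁ D,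
      Set.image2 (· + ·) E₁ E ∪
        (fun z : H × H × G => z.1 + z.2.1 - q z.2.2) '' (E₁ ×ˢ E ×ˢ D₁),
      (hD.union hD₁).union (hD₁.image2 _ hD),
      (hE₁.image2 _ hE).union ((hE₁.prod (hE.prod hD₁)).image _), fun χ => ?_⟩
    obtain ⟨h, hh, x, hx, hxS, hmono⟩ := hDE₁ fun h z => χ (h + z)
    have hshift : ∀ p ∈ A, ∀ y ∈ insert 0 D, ∀ z ∈ Q,
        χ (h + (p (x + y) - p y - q x) + z) = χ (h + z) := fun p hp y hy z hz =>
      congrFun (hmono _ (Set.mem_image2_of_mem hp hy)) ⟨z, hz⟩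
    rcases hDE fun z => χ (h + z) with ⟨a, ha, y, hy, hyS, hc⟩ | ⟨a, ha, T, hT, hc⟩
    · refine Or.inl ⟨h + a, Or.inl (Set.mem_image2_of_mem hh ha), y, Or.inl (Or.inl hy), hyS,
        fun p hp => ?_⟩
      rw [add_assoc]
      exact hc p hp
    by_cases hmem : χ (h + a) ∈ T
    · obtain ⟨y, hy, hyS, hyc⟩ := hc _ hmem
      refine Or.inl ⟨h + a, Or.inl (Set.mem_image2_of_mem hh ha), y, Or.inl (Or.inl hy), hyS,
        fun p hp => ?_⟩
      rw [add_assoc]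
      exact hyc p hp
    -- Seen from this focus, `p (x + y)` leads to `h + a + p y` moved by a shifted map, which
    -- preserves its color; `y = 0` gives the new color `χ (h + a)`.
    refine Or.inr ⟨h + a - q x, Or.inr ⟨(h, a, x), ⟨hh, ha, hx⟩, rfl⟩, insert (χ (h + a)) T,
      by rw [Finset.card_insert_of_notMem hmem, hT], fun c hcT => ?_⟩
    rcases Finset.mem_insert.1 hcT with rfl | hcT
    · refine ⟨x, Or.inl (Or.inr hx), fun hs => hxS (Or.inl hs), fun p hp => ?_⟩
      rw [← hshift p hp 0 (Set.mem_insert _ _) a (Or.inl ha), hA0 p hp, add_zero]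
      congr 1
      abel
    · obtain ⟨y, hy, -, hyc⟩ := hc c hcT
      refine ⟨x + y, Or.inr (Set.mem_image2_of_mem hx hy), fun hs =>
        hxS (Or.inr ⟨x + y, hs, y, hy, add_sub_cancel_right x y⟩), fun p hp => ?_⟩
      rw [← hyc p hp, ← hshift p hp y (Set.mem_insert_of_mem _ hy) (a + p y)
        (Or.inr ⟨(a, p, y), ⟨ha, hp, hy⟩, rfl⟩)]
      congr 1
      abel

theorem IsPartitionRegularFamily.of_shiftedFamily {A : Set (G → H)} (hA : A.Finite)
    (hA0 : ∀ p ∈ A, p 0 = 0) (q : G → H)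
    (hB : ∀ Y : Set G, Y.Finite → IsPartitionRegularFamily (shiftedFamily A q Y)) :
    IsPartitionRegularFamily A := by
  intro C _ S hS
  have := Fintype.ofFinite C
  obtain ⟨D, E, hD, hE, hDE⟩ :=
    exists_monochromatic_or_focused hA hA0 q hB C hS (Fintype.card C + 1)
  refine ⟨D, E, hD, hE, fun χ => (hDE χ).resolve_right ?_⟩
  -- There are too few colors for this many distinct ones.
  rintro ⟨-, -, T, hT, -⟩
  have := T.card_le_univ
  omega

/-! ### Induction on the multiset of degrees -/

/-- The multiset `K` of pairs `(f, d)`, where `f` has degree at most `d + 1`, covers the family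
`A`: each member of `A` differs from one of the `f` by a map of degree at most `d`. -/
def IsDegreeCover (K : Multiset ((G → H) × ℕ)) (A : Set (G → H)) : Prop :=
  (∀ k ∈ K, k.1 ∈ degreeLT G H (k.2 + 2)) ∧
    ∀ p ∈ A, ∃ k ∈ K, p - k.1 ∈ degreeLT G H (k.2 + 1)

theorem shiftedFamily_apply_zero {A : Set (G → H)} {q : G → H} (hq : q 0 = 0) {Y : Set G} :
    ∀ p ∈ shiftedFamily A q Y, p 0 = 0 := by
  rintro - ⟨p, -, y, -, rfl⟩
  simp [hq]

/-- If the class of `q` has minimal degree, passing to the shifted family replaces this class by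
classes of smaller degree. -/
theorem IsDegreeCover.exists_shiftedFamily {K : Multiset ((G → H) × ℕ)} {f : G → H} {d : ℕ}
    {A : Set (G → H)} (hA : A.Finite) (hA0 : ∀ p ∈ A, p 0 = 0)
    (hK : IsDegreeCover ((f, d) ::ₘ K) A) (hd : ∀ k ∈ K, d ≤ k.2) {q : G → H} (hq : q ∈ A)
    (hqf : q - f ∈ degreeLT G H (d + 1)) {Y : Set G} (hY : Y.Finite) :
    ∃ L : Multiset ((G → H) × ℕ), (∀ k ∈ L, k.2 < d) ∧
      IsDegreeCover (K.map (fun k => (k.1 - q, k.2)) + L) (shiftedFamily A q Y \ {0}) := by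
  obtain ⟨hKdeg, hcov⟩ := hK
  have hdeg : ∀ k ∈ (f, d) ::ₘ K, ∀ p : G → H, p - k.1 ∈ degreeLT G H (k.2 + 1) →
      p ∈ degreeLT G H (k.2 + 2) := fun k hk p hp => by
    simpa using add_mem (degreeLT_le_succ _ hp) (hKdeg k hk)
  have hqdeg : q ∈ degreeLT G H (d + 2) := hdeg _ (Multiset.mem_cons_self _ _) q hqf
  have hmap : ∀ k ∈ K.map (fun k => (k.1 - q, k.2)), k.1 ∈ degreeLT G H (k.2 + 2) := by
    intro k hk
    obtain ⟨k, hkK, rfl⟩ := Multiset.mem_map.1 hk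
    exact sub_mem (hKdeg k (Multiset.mem_cons_of_mem hkK))
      (degreeLT_mono (Nat.add_le_add_right (hd k hkK) 2) hqdeg)
  have hsplit : ∀ g ∈ shiftedFamily A q Y, g ∈ degreeLT G H (d + 1) ∨
      ∃ k ∈ K.map (fun k => (k.1 - q, k.2)), g - k.1 ∈ degreeLT G H (k.2 + 1) := by
    rintro - ⟨p, hp, y, -, rfl⟩
    obtain ⟨k, hk, hpk⟩ := hcov p hp
    have hdiff := difference_mem_degreeLT (hdeg k hk p hpk) y
    rcases Multiset.mem_cons.1 hk with rfl | hkK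
    -- Here `p` and `q` share the class of `f`, so their leading parts cancel.
    · left
      convert add_mem hdiff (sub_mem hpk hqf) using 1
      ext x
      simp only [Pi.add_apply, Pi.sub_apply]
      abel
    · refine Or.inr ⟨_, Multiset.mem_map_of_mem _ hkK, ?_⟩
      convert add_mem hdiff hpk using 1
      ext x
      simp only [Pi.add_apply, Pi.sub_apply]
      abel
  rcases d with _ | e
  -- For `d = 0` the class of `q` leaves only constants vanishing at 0, and the zero map has been
  -- removed.
  · refine ⟨0, by simp, ?_⟩
    rw [add_zero]
    refine ⟨hmap, fun g hg => (hsplit g hg.1).resolve_left fun h => hg.2 ?_⟩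
    exact eq_zero_of_mem_degreeLT_one h (shiftedFamily_apply_zero (hA0 q hq) g hg.1)
  · have hfin : (shiftedFamily A q Y ∩ {g | g ∈ degreeLT G H (e + 2)}).Finite :=
      (hA.image2 _ hY).inter_of_left _
    -- Each map of lowered degree becomes its own class.
    refine ⟨hfin.toFinset.val.map fun g => (g, e), ?_, ?_, fun g hg => ?_⟩
    · intro k hk
      obtain ⟨g, -, rfl⟩ := Multiset.mem_map.1 hk
      exact Nat.lt_succ_self e
    · intro k hk
      rcases Multiset.mem_add.1 hk with hk | hk
      · exact hmap k hk
      · obtain ⟨g, hg, rfl⟩ := Multiset.mem_map.1 hk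
        exact (hfin.mem_toFinset.1 hg).2
    · rcases hsplit g hg.1 with h | ⟨k, hk, hgk⟩
      · refine ⟨(g, e), Multiset.mem_add.2 (Or.inr (Multiset.mem_map_of_mem _
          (hfin.mem_toFinset.2 ⟨hg.1, h⟩))), ?_⟩
        rw [sub_self]
        exact zero_mem _
      · exact ⟨k, Multiset.mem_add.2 (Or.inl hk), hgk⟩

theorem IsDegreeCover.isPartitionRegularFamily [Infinite G] {K : Multiset ((G → H) × ℕ)}
    {A : Set (G → H)} (hA : A.Finite) (hA0 : ∀ p ∈ A, p 0 = 0) (hK : IsDegreeCover K A) :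
    IsPartitionRegularFamily A := by
  obtain ⟨m, hm⟩ : ∃ m, K.map Prod.snd = m := ⟨_, rfl⟩
  induction m using
    (Multiset.wellFounded_isDershowitzMannaLT (α := ℕ)).induction generalizing K A with
  | _ m ih
  subst hm
  classical
  rcases K.empty_or_exists_mem with rfl | hne
  · obtain rfl : A = ∅ := Set.eq_empty_of_forall_notMem fun p hp => by simpa using hK.2 p hp
    exact .empty
  obtain ⟨⟨f, d⟩, hmem, hmin⟩ := K.toFinset.exists_min_image Prod.snd
    (by simpa [Finset.Nonempty] using hne)
  simp only [Multiset.mem_toFinset] at hmem hmin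
  obtain ⟨K, rfl⟩ := Multiset.exists_cons_of_mem hmem
  have hd : ∀ k ∈ K, d ≤ k.2 := fun k hk => hmin k (Multiset.mem_cons_of_mem hk)
  by_cases hq : ∃ q ∈ A, q - f ∈ degreeLT G H (d + 1)
  · obtain ⟨q, hq, hqf⟩ := hq
    refine .of_shiftedFamily hA hA0 q fun Y hY => .of_diff_zero ?_
    obtain ⟨L, hL, hcov⟩ := hK.exists_shiftedFamily hA hA0 hd hq hqf hY
    refine ih _ ?_ ((hA.image2 _ hY).sdiff)
      (fun p hp => shiftedFamily_apply_zero (hA0 q hq) p hp.1) hcov rfl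
    refine ⟨K.map Prod.snd, L.map Prod.snd, {d}, by simp, by simp, ?_, ?_⟩
    · rw [Multiset.map_cons, ← Multiset.singleton_add, add_comm]
    · intro y hy
      obtain ⟨k, hk, rfl⟩ := Multiset.mem_map.1 hy
      exact ⟨d, by simp, hL k hk⟩
  -- No member lies in the class of `f`, so the class can be dropped.
  · refine ih _ ?_ hA hA0 (K := K) ⟨fun k hk => hK.1 k (Multiset.mem_cons_of_mem hk), ?_⟩ rfl
    · refine ⟨K.map Prod.snd, 0, {d}, by simp, by simp, ?_, by simp⟩
      rw [Multiset.map_cons, ← Multiset.singleton_add, add_comm]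
    · intro p hp
      obtain ⟨k, hk, hpk⟩ := hK.2 p hp
      rcases Multiset.mem_cons.1 hk with rfl | hk
      · exact absurd ⟨p, hp, hpk⟩ hq
      · exact ⟨k, hk, hpk⟩

theorem isPartitionRegularFamily_of_mem_degreeLT [Infinite G] {A : Set (G → H)} (hA : A.Finite)
    (hA0 : ∀ p ∈ A, p 0 = 0) (hdeg : ∀ p ∈ A, ∃ d, p ∈ degreeLT G H d) :
    IsPartitionRegularFamily A := by
  choose! d hd using hdeg
  refine IsDegreeCover.isPartitionRegularFamily
    (K := hA.toFinset.val.map fun p => (p, d p)) hA hA0 ⟨?_, ?_⟩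
  · simp only [Multiset.mem_map, Finset.mem_val, Set.Finite.mem_toFinset]
    rintro - ⟨p, hp, rfl⟩
    exact degreeLT_mono (Nat.le_add_right _ 2) (hd p hp)
  · refine fun p hp => ⟨(p, d p), Multiset.mem_map_of_mem _ (by simpa using hp), ?_⟩
    simp

end Recurrence

theorem corollary7p11 {G : Type*} [NonUnitalRing G] [Infinite G] (n t : ℕ)
    (P : (Fin n → G) → (Fin t → G)) (hP : IsPolynomialMapping P) (hP0 : P 0 = 0)
    (F : Set (Fin n → G)) (hF : F.Finite)
    (r : ℕ) (χ : (Fin t → G) → Fin r) :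
    ∃ (h : Fin t → G) (x : G), x ≠ 0 ∧
      IsMonochromatic χ ((fun v => h + P (fun i => x * v i)) '' F) := by
  have hreg : IsPartitionRegularFamily ((fun v (x : G) => P fun i => x * v i) '' F) := by
    refine isPartitionRegularFamily_of_mem_degreeLT (hF.image _) ?_ ?_
    · rintro - ⟨v, -, rfl⟩
      simp only [zero_mul]
      exact hP0
    · rintro - ⟨v, -, rfl⟩
      exact hP.exists_mem_degreeLT v
  -- Excluding `{0}` yields `x ≠ 0`; `ULift` puts the colors in the universe of `Fin t → G`.
  obtain ⟨D, E, -, -, hDE⟩ := hreg (ULift (Fin r)) {0} (Set.finite_singleton _)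
  obtain ⟨h, -, x, -, hx, hmono⟩ := hDE fun z => ⟨χ z⟩
  have key : ∀ v ∈ F, χ (h + P fun i => x * v i) = χ h := fun v hv =>
    ULift.up_injective (hmono _ ⟨v, hv, rfl⟩)
  refine ⟨h, x, hx, ?_⟩
  rintro - ⟨v, hv, rfl⟩ - ⟨w, hw, rfl⟩
  exact (key v hv).trans (key w hw).symm
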